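/- Let $q$ be a prime power and let $n\ge 3$ and $1\le d\le q$ be integers. A matrix $H\neq 0$ with entries in $\mathbb F_{q^2}$ is called Hermitian if $H^T=H^{(q)}$, where $H^{(q)}$ is obtained from $H$ by raising every entry to the $q$-th power; an $(m+1)\times(m+1)$ Hermitian matrix $H$ defines the Hermitian variety $V(x^THx^{(q)})\subset\mathbb P^m$, where $x=(x_0,\dots,x_m)^T$ and $x^{(q)}=(x_0^q,\dots,x_m^q)^T$. Its rank is the rank of $H$, and it is non-degenerate if this rank is $m+1$. Let $P\mathcal U_{n-1}$ be a Hermitian variety of rank $n$ in $\mathbb P^n$ and let $\mathcal U_{n-1}$ be a non-degenerate Hermitian variety in $\mathbb P^{n-1}$, both over $\mathbb F_{q^2}$. Let $F\in\mathbb F_{q^2}[x_0,\dots,x_n]$ be a nonzero homogeneous polynomial of degree $d$, and let $V(F)\subset\mathbb P^n$ be the hypersurface it defines. Then $$|(P\mathcal U_{n-1}\cap V(F))(\mathbb F_{q^2})|\le \max\left\{|\mathcal U_{n-1}(\mathbb F_{q^2})|+(d-1)(q+1)q^{2n-4},\ 1+q^2M_{n-1}(d)\right\},$$ where $M_{n-1}(d):=\max_{G}|(\mathcal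 U_{n-1}\cap V(G))(\mathbb F_{q^2})|$, the maximum being taken over all nonzero homogeneous polynomials $G\in\mathbb F_{q^2}[x_0,\dots,x_{n-1}]$ of degree $d$. -/

import Mathlib

open scoped LinearAlgebra.Projectivization

noncomputable section

/-- The set of `K`-rational points of the projective hypersurface `V(F)`. For homogeneous `F` the
choice of the representative is irrelevant, see `mk_mem_projZeros`. -/
def projZeros {K σ : Type*} [Field K] (F : MvPolynomial σ K) : Set (ℙ K (σ → K)) :=
  {P | MvPolynomial.eval P.rep F = 0}

theorem mk_mem_projZeros {K σ : Type*} [Field K] {F : MvPolynomial σ K} {d : ℕ}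
    (hF : F.IsHomogeneous d) (v : σ → K) (hv : v ≠ 0) :
    Projectivization.mk K v hv ∈ projZeros F ↔ MvPolynomial.eval v F = 0 := by
  obtain ⟨a, ha⟩ := Projectivization.exists_smul_eq_mk_rep K v hv
  have h : MvPolynomial.eval (a • v) F = (a : K) ^ d * MvPolynomial.eval v F := by
    rw [MvPolynomial.eval_eq, MvPolynomial.eval_eq, Finset.mul_sum]
    refine Finset.sum_congr rfl fun m hm => ?_
    have hdeg : ∑ i ∈ m.support, m i = d := by
      have := hF (MvPolynomial.mem_support_iff.mp hm)
      simpa [Finsupp.weight_apply, Finsupp.sum] using this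
    simp only [Pi.smul_apply, Units.smul_def, smul_eq_mul, mul_pow, Finset.prod_mul_distrib,
      Finset.prod_pow_eq_pow_sum, hdeg]
    ring
  change MvPolynomial.eval (Projectivization.mk K v hv).rep F = 0 ↔ _
  rw [← ha, h]
  simp

/-- Hermitian matrices over the field with `q ^ 2` elements: `H ≠ 0` and `Hᵀ = H^(q)`. -/
def IsHermitianMatrix {K ι : Type*} [Field K] (q : ℕ) (H : Matrix ι ι K) : Prop :=
  H ≠ 0 ∧ H.transpose = H.map (fun a => a ^ q)

/-- The polynomial `xᵀ H x^(q)` defining the Hermitian variety of `H`. -/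
def hermitianPoly {K ι : Type*} [Field K] [Fintype ι] (q : ℕ) (H : Matrix ι ι K) :
    MvPolynomial ι K :=
  ∑ i, ∑ j, MvPolynomial.C (H i j) * MvPolynomial.X i * MvPolynomial.X j ^ q

theorem hermitianPoly_isHomogeneous {K ι : Type*} [Field K] [Fintype ι] (q : ℕ)
    (H : Matrix ι ι K) : (hermitianPoly q H).IsHomogeneous (q + 1) := by
  refine MvPolynomial.IsHomogeneous.sum _ _ _ fun i _ =>
    MvPolynomial.IsHomogeneous.sum _ _ _ fun j _ => ?_
  have h := ((MvPolynomial.isHomogeneous_C ι (H i j)).mul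
    (MvPolynomial.isHomogeneous_X K i)).mul ((MvPolynomial.isHomogeneous_X K j).pow q)
  convert h using 1
  ring

/-- The set of rational points of the Hermitian variety of `H`. -/
def hermitianPoints {K ι : Type*} [Field K] [Fintype ι] (q : ℕ) (H : Matrix ι ι K) :
    Set (ℙ K (ι → K)) :=
  projZeros (hermitianPoly q H)

/-- The numbers of rational points that the Hermitian variety of `H` shares with the
hypersurfaces of degree `d`. -/
def hermitianIntersectionNumbers {K ι : Type*} [Field K] [Fintype ι] (q d : ℕ)
    (H : Matrix ι ι K) : Set ℕ :=
  {m | ∃ G : MvPolynomial ι K, G.IsHomogeneous d ∧ G ≠ 0 ∧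
    m = (hermitianPoints q H ∩ projZeros G).ncard}

/-- The maximal number of rational points that a hypersurface of degree `d` shares with the
Hermitian variety of `H`. -/
def hermitianMax {K ι : Type*} [Field K] [Fintype ι] (q d : ℕ) (H : Matrix ι ι K) : ℕ :=
  sSup (hermitianIntersectionNumbers q d H)

theorem hermitianMax_isGreatest {K ι : Type*} [Field K] [Finite K] [Fintype ι] [Nonempty ι]
    (q d : ℕ) (H : Matrix ι ι K) :
    IsGreatest (hermitianIntersectionNumbers q d H) (hermitianMax q d H) := by
  have hne : (hermitianIntersectionNumbers q d H).Nonempty := by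
    obtain ⟨i⟩ := ‹Nonempty ι›
    refine ⟨_, MvPolynomial.X i ^ d, ?_, pow_ne_zero _ (MvPolynomial.X_ne_zero i), rfl⟩
    simpa using (MvPolynomial.isHomogeneous_X K i).pow d
  have hbdd : BddAbove (hermitianIntersectionNumbers q d H) := by
    refine ⟨(hermitianPoints q H).ncard, ?_⟩
    rintro _ ⟨G, -, -, rfl⟩
    exact Set.ncard_le_ncard Set.inter_subset_left (Set.toFinite _)
  exact ⟨Nat.sSup_mem hne hbdd, fun _ hm => le_csSup hbdd hm⟩

end

/-! By `exists_linearEquiv_cone`, coordinates can be chosen in which the cone is given by the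
equation of `U` in `x₁, …, xₙ`, with vertex `(1:0:…:0)`. Write `F = G x₀ᵉ + (lower powers of x₀)`
with `G ≠ 0` a form of degree `d - e` in the other variables. Over an isotropic vector `x` of `U`,
at most `e` values of `x₀` give zeros of `F` when `G(x) ≠ 0`, and at most `q²` otherwise
(`card_zeros_over_le`).

If `e = 0`, then `V(F)` is itself a cone over `V(G)`, which gives `1 + q² M` with `1` for the
vertex. If `e ≥ 1`, put `N = |U|` and `D = (q+1)q^(2n-4)`. Then `N ≤ D` (`card_isotropic_le`), and
for `e < d` at most `(d-e)D` isotropic vectors are zeros of `G` (`card_isotropic_zeros_le`). The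
fibre count yields `N + (e-1)D + (d-e)D`; for `e = d` the constant `G` has no zeros.

The bound for `G`, of degree `k`, comes from averaging over the translates of a plane `⟨p, v⟩`,
where `p` is isotropic with `G(p) ≠ 0` and `v ⟂ p` is anisotropic. On each translate the two curves,
of degrees `q+1` and `k`, share no point at infinity, so Bézout allows at most `k(q+1)` common
points.

Counts are of vectors in affine cones; `card_cone_eq` converts them to projective points. -/

open scoped LinearAlgebra.Projectivization

/-! ### Conjugation, trace and norm of the quadratic extension. -/

section FieldFacts

variable {K : Type*} [Field K] [Fintype K] {q : ℕ}

theorem two_le_of_card_eq_sq (hq : Fintype.card K = q ^ 2) : 2 ≤ q := by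
  have := Fintype.one_lt_card (α := K)
  by_contra h
  interval_cases q <;> omega

/-- As `q` divides `q² = |K|`, it is a power of the characteristic, so `x ↦ x^q` is an iterate of
Frobenius. -/
theorem add_pow_of_card_eq_sq (hq : Fintype.card K = q ^ 2) (x y : K) :
    (x + y) ^ q = x ^ q + y ^ q := by
  obtain ⟨p, hc⟩ := CharP.exists K
  obtain ⟨m, hp, hm⟩ := FiniteField.card K p
  obtain ⟨s, -, rfl⟩ := (Nat.dvd_prime_pow hp).1
    (hm ▸ hq ▸ Dvd.intro_left q (by ring) : q ∣ p ^ (m : ℕ))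
  have := Fact.mk hp
  exact add_pow_char_pow x y p s

theorem sum_pow_of_card_eq_sq (hq : Fintype.card K = q ^ 2) {ι : Type*} (s : Finset ι)
    (f : ι → K) : (∑ i ∈ s, f i) ^ q = ∑ i ∈ s, f i ^ q := by
  classical
  have h2 := two_le_of_card_eq_sq hq
  induction s using Finset.induction_on with
  | empty => simp; omega
  | insert a s ha ih => rw [Finset.sum_insert ha, Finset.sum_insert ha,
      add_pow_of_card_eq_sq hq, ih]

theorem neg_pow_of_card_eq_sq (hq : Fintype.card K = q ^ 2) (x : K) : (-x) ^ q = -x ^ q := by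
  have h := add_pow_of_card_eq_sq hq x (-x)
  have := two_le_of_card_eq_sq hq
  rw [add_neg_cancel, zero_pow (by omega)] at h
  linear_combination -h

theorem pow_pow_of_card_eq_sq (hq : Fintype.card K = q ^ 2) (x : K) : (x ^ q) ^ q = x := by
  rw [← pow_mul, ← sq, ← hq, FiniteField.pow_card]

/-- The trace `z + z ^ q` does not vanish identically. -/
theorem exists_add_pow_ne_zero (hq : Fintype.card K = q ^ 2) : ∃ z : K, z + z ^ q ≠ 0 := by
  classical
  have h2 := two_le_of_card_eq_sq hq
  by_contra! h
  set P : Polynomial K := Polynomial.X + Polynomial.X ^ q with hP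
  have hdeg : P.natDegree = q := by
    rw [hP, Polynomial.natDegree_add_eq_right_of_natDegree_lt] <;> simp
    omega
  have hP0 : P = 0 := by
    refine Polynomial.eq_zero_of_natDegree_lt_card_of_eval_eq_zero' P Finset.univ
      (fun x _ => by simpa [hP] using h x) ?_
    rw [hdeg, Finset.card_univ, hq]
    nlinarith
  rw [hP0] at hdeg
  simp at hdeg
  omega

/-- The fibres of the norm `t ↦ t ^ (q + 1)` over the nonzero elements of the subfield. -/
theorem card_norm_fiber [DecidableEq K] (hq : Fintype.card K = q ^ 2) {a : K} (ha : a ≠ 0)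
    (haq : a ^ q = a) : (Finset.univ.filter fun t : K => t ^ (q + 1) = a).card = q + 1 := by
  have h2 := two_le_of_card_eq_sq hq
  have hroots : ∀ (m : ℕ) (b : K), 0 < m →
      (Finset.univ.filter fun t : K => t ^ m = b).card ≤ m := by
    intro m b hm
    refine le_trans (Finset.card_le_card (t := (Polynomial.nthRoots m b).toFinset) ?_)
      ((Multiset.toFinset_card_le _).trans (Polynomial.card_nthRoots m b))
    intro t ht
    simpa [Polynomial.mem_nthRoots hm] using ht
  obtain ⟨r, rfl⟩ : ∃ r, q = r + 1 := ⟨q - 1, by omega⟩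
  have hr : 0 < r := by omega
  set B := Finset.univ.filter fun b : K => b ^ r = 1
  have hmaps : ∀ t ∈ Finset.univ.erase (0 : K), t ^ (r + 1 + 1) ∈ B := by
    intro t ht
    have ht0 : t ≠ 0 := by simpa using ht
    have h1 := FiniteField.pow_card_sub_one_eq_one t ht0
    rw [hq] at h1
    simp only [B, Finset.mem_filter, Finset.mem_univ, true_and]
    rw [← pow_mul, ← h1]
    congr 1
    zify [Nat.one_le_pow 2 (r + 1) (by omega)]
    ring
  have hsum := Finset.card_eq_sum_card_fiberwise hmaps
  rw [Finset.card_erase_of_mem (Finset.mem_univ _), Finset.card_univ, hq] at hsum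
  have hfib : ∀ b ∈ B, ((Finset.univ.erase (0 : K)).filter fun t => t ^ (r + 1 + 1) = b).card
      ≤ r + 1 + 1 := fun b _ =>
    (Finset.card_le_card (Finset.filter_subset_filter _ (Finset.erase_subset _ _))).trans
      (hroots _ b (by omega))
  have haB : a ∈ B := by
    simp only [B, Finset.mem_filter, Finset.mem_univ, true_and]
    have : a ^ r * a = 1 * a := by rw [← pow_succ, haq, one_mul]
    exact mul_right_cancel₀ ha this
  -- At most `q - 1` fibres, each of size at most `q + 1`, exhaust `q² - 1` elements. Bounding all
  -- fibres but the one over `a` forces that one to be full.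
  have hle := Finset.sum_le_sum (fun b hb => hfib b (Finset.mem_of_mem_erase hb) :
    ∀ b ∈ B.erase a, _ ≤ _)
  rw [← Finset.add_sum_erase _ _ haB] at hsum
  rw [Finset.sum_const, Finset.card_erase_of_mem haB, smul_eq_mul] at hle
  have hB : B.card ≤ r := hroots r 1 hr
  refine le_antisymm (hroots _ a (by omega)) ?_
  refine le_trans ?_ (Finset.card_le_card
    (Finset.filter_subset_filter _ (Finset.erase_subset (0 : K) Finset.univ)))
  have h3 : (B.card - 1) * (r + 1 + 1) ≤ (r - 1) * (r + 1 + 1) :=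
    Nat.mul_le_mul_right _ (by omega)
  have h4 : (r + 1) ^ 2 - 1 = (r - 1) * (r + 1 + 1) + (r + 1 + 1) := by
    obtain ⟨s, rfl⟩ : ∃ s, r = s + 1 := ⟨r - 1, by omega⟩
    simp only [Nat.add_sub_cancel]
    zify [Nat.one_le_pow 2 (s + 1 + 1) (by omega)]
    ring
  omega

theorem exists_pow_succ_eq (hq : Fintype.card K = q ^ 2) {a : K} (ha : a ≠ 0) (haq : a ^ q = a) :
    ∃ t : K, t ^ (q + 1) = a := by
  classical
  have h := card_norm_fiber hq ha haq
  obtain ⟨t, ht⟩ := Finset.card_pos.1 (by rw [h]; omega :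
    0 < (Finset.univ.filter fun t : K => t ^ (q + 1) = a).card)
  exact ⟨t, (Finset.mem_filter.1 ht).2⟩

end FieldFacts

/-! ### Bézout's bound in the affine plane by counting dimensions. -/

section PlaneBezout

variable {K A : Type*} [Field K] [CommRing A] [Algebra K A]

/-- The span of the monomials `x ^ i * y ^ j` with `i + j ≤ k` and `i < k`. -/
def lowerMonomialSpan (K : Type*) {A : Type*} [Field K] [CommRing A] [Algebra K A] (x y : A)
    (k : ℕ) : Submodule K A :=
  Submodule.span K {f | ∃ i j, i + j ≤ k ∧ i < k ∧ f = x ^ i * y ^ j}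

theorem monomial_mem_lowerMonomialSpan (x y : A) {i j k : ℕ} (h : i + j ≤ k) (hi : i < k) :
    x ^ i * y ^ j ∈ lowerMonomialSpan K x y k :=
  Submodule.subset_span ⟨i, j, h, hi, rfl⟩

theorem mul_mem_lowerMonomialSpan {x y f g : A} {k l : ℕ} (hf : f ∈ lowerMonomialSpan K x y k)
    (hg : g ∈ lowerMonomialSpan K x y l) : f * g ∈ lowerMonomialSpan K x y (k + l) := by
  have h := Submodule.mul_mem_mul hf hg
  rw [lowerMonomialSpan, lowerMonomialSpan, Submodule.span_mul_span] at h
  refine Submodule.span_le.2 ?_ h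
  rintro _ ⟨_, ⟨i, j, h1, h2, rfl⟩, _, ⟨i', j', h3, h4, rfl⟩, rfl⟩
  exact Submodule.subset_span ⟨i + i', j + j', by omega, by omega, by ring⟩

theorem pow_mul_mem_lowerMonomialSpan {x y g : A} (k : ℕ) {l : ℕ}
    (hg : g ∈ lowerMonomialSpan K x y l) : x ^ k * g ∈ lowerMonomialSpan K x y (k + l) := by
  have h := Submodule.mul_mem_mul (Submodule.mem_span_singleton_self (R := K) (x ^ k)) hg
  rw [lowerMonomialSpan, Submodule.span_mul_span] at h
  refine Submodule.span_le.2 ?_ h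
  rintro _ ⟨_, rfl, _, ⟨i', j', h3, h4, rfl⟩, rfl⟩
  exact Submodule.subset_span ⟨k + i', j', by omega, by omega, by ring⟩

/-- `f` is `c * x ^ k` plus a combination of monomials of degree at most `k` in `x` and `y` and
degree less than `k` in `x`. -/
def HasLeading (x y : A) (k : ℕ) (c : K) (f : A) : Prop :=
  f - c • x ^ k ∈ lowerMonomialSpan K x y k

/-- With remainders `r = f - c x^k` and `s = g - e x^l`, the remainder of `f g` is `r s + c x^k s +
e x^l r`. -/
theorem HasLeading.mul {x y f g : A} {k l : ℕ} {c e : K} (hf : HasLeading x y k c f)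
    (hg : HasLeading x y l e g) : HasLeading x y (k + l) (c * e) (f * g) := by
  have h1 := mul_mem_lowerMonomialSpan hf hg
  have h2 := Submodule.smul_mem _ c (pow_mul_mem_lowerMonomialSpan k hg)
  have h3 := Submodule.smul_mem _ e (pow_mul_mem_lowerMonomialSpan l hf)
  rw [add_comm l k] at h3
  have := Submodule.add_mem _ (Submodule.add_mem _ h1 h2) h3
  unfold HasLeading
  convert this using 1
  simp only [Algebra.smul_def, map_mul]
  ring

theorem HasLeading.one (x y : A) : HasLeading x y 0 (1 : K) 1 := by
  simp [HasLeading]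

theorem HasLeading.pow {x y f : A} {c : K} (hf : HasLeading x y 1 c f) (m : ℕ) :
    HasLeading x y m (c ^ m) (f ^ m) := by
  induction m with
  | zero => simpa using HasLeading.one x y
  | succ m ih => rw [pow_succ, pow_succ]; exact ih.mul hf

theorem HasLeading.prod {x y : A} {ι : Type*} (s : Finset ι) (k : ι → ℕ) (c : ι → K) (f : ι → A)
    (h : ∀ i ∈ s, HasLeading x y (k i) (c i) (f i)) :
    HasLeading x y (∑ i ∈ s, k i) (∏ i ∈ s, c i) (∏ i ∈ s, f i) := by
  classical
  induction s using Finset.induction_on with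
  | empty => simpa using HasLeading.one x y
  | insert a s ha ih =>
    rw [Finset.sum_insert ha, Finset.prod_insert ha, Finset.prod_insert ha]
    exact (h a (by simp)).mul (ih fun i hi => h i (by simp [hi]))

theorem HasLeading.smul {x y f : A} {k : ℕ} {c : K} (a : K) (hf : HasLeading x y k c f) :
    HasLeading x y k (a * c) (a • f) := by
  have := Submodule.smul_mem _ a hf
  rwa [smul_sub, smul_smul] at this

theorem HasLeading.sum {x y : A} {ι : Type*} (s : Finset ι) (k : ℕ) (c : ι → K) (f : ι → A)
    (h : ∀ i ∈ s, HasLeading x y k (c i) (f i)) :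
    HasLeading x y k (∑ i ∈ s, c i) (∑ i ∈ s, f i) := by
  unfold HasLeading
  rw [Finset.sum_smul, ← Finset.sum_sub_distrib]
  exact Submodule.sum_mem _ h

theorem hasLeading_linear (x y : A) (u p v : K) :
    HasLeading x y 1 p (algebraMap K A u + p • x + v • y) := by
  have h1 : (1 : A) ∈ lowerMonomialSpan K x y 1 := by
    simpa using monomial_mem_lowerMonomialSpan (K := K) x y (i := 0) (j := 0) (k := 1)
      (by omega) (by omega)
  have h2 : y ∈ lowerMonomialSpan K x y 1 := by
    simpa using monomial_mem_lowerMonomialSpan (K := K) x y (i := 0) (j := 1) (k := 1)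
      (by omega) (by omega)
  have := Submodule.add_mem _ (Submodule.smul_mem _ u h1) (Submodule.smul_mem _ v h2)
  unfold HasLeading
  convert this using 1
  rw [Algebra.algebraMap_eq_smul_one, pow_one]
  abel

/-- The leading coefficient of a form of degree `k` restricted to an affine plane. -/
theorem hasLeading_aeval {σ : Type*} {G : MvPolynomial σ K} {k : ℕ} (hG : G.IsHomogeneous k)
    (x y : A) (u p v : σ → K) :
    HasLeading x y k (MvPolynomial.eval p G)
      (MvPolynomial.aeval (fun l => algebraMap K A (u l) + p l • x + v l • y) G) := by
  rw [MvPolynomial.eval_eq, MvPolynomial.aeval_def, MvPolynomial.eval₂_eq]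
  refine HasLeading.sum _ _ _ _ fun m hm => ?_
  rw [← Algebra.smul_def]
  refine HasLeading.smul _ ?_
  have hdeg : ∑ i ∈ m.support, m i = k := by
    have := hG (MvPolynomial.mem_support_iff.mp hm)
    simpa [Finsupp.weight_apply, Finsupp.sum] using this
  rw [← hdeg]
  exact HasLeading.prod _ _ _ _ fun i _ => (hasLeading_linear x y _ _ _).pow _

/-- If `y ^ a` is a combination of monomials of smaller degree and `x ^ b` is one of monomials of
degree at most `b` and smaller degree in `x`, then the `x ^ i * y ^ j` with `i < b`, `j < a` span
all monomials. -/
theorem monomial_mem_span_box {x y : A} {a b : ℕ}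
    (hy : y ^ a ∈ Submodule.span K {f | ∃ i j, i + j < a ∧ f = x ^ i * y ^ j})
    (hx : x ^ b ∈ lowerMonomialSpan K x y b) (i j : ℕ) :
    x ^ i * y ^ j ∈ Submodule.span K
      (Set.range fun ij : Fin b × Fin a => x ^ (ij.1 : ℕ) * y ^ (ij.2 : ℕ)) := by
  set S := Submodule.span K
      (Set.range fun ij : Fin b × Fin a => x ^ (ij.1 : ℕ) * y ^ (ij.2 : ℕ))
  -- Induction on the total degree `D`, then on the `x`-degree: replacing `y ^ a` lowers the former,
  -- while replacing `x ^ b` lowers the latter without raising the former.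
  suffices ∀ D i j, i + j = D → x ^ i * y ^ j ∈ S from this _ i j rfl
  intro D
  induction D using Nat.strong_induction_on with
  | _ D ihD =>
  intro i
  induction i using Nat.strong_induction_on with
  | _ i ihi =>
  intro j hij
  by_cases hj : a ≤ j
  · obtain ⟨j, rfl⟩ := Nat.exists_eq_add_of_le hj
    have h := Submodule.mul_mem_mul
      (Submodule.mem_span_singleton_self (R := K) (x ^ i * y ^ j)) hy
    rw [Submodule.span_mul_span] at h
    have h2 : x ^ i * y ^ (a + j) = x ^ i * y ^ j * y ^ a := by ring
    rw [h2]
    refine Submodule.span_le.2 ?_ h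
    rintro _ ⟨_, rfl, _, ⟨i', j', h3, rfl⟩, rfl⟩
    have h4 : x ^ i * y ^ j * (x ^ i' * y ^ j') = x ^ (i + i') * y ^ (j + j') := by ring
    change x ^ i * y ^ j * (x ^ i' * y ^ j') ∈ S
    rw [h4]
    exact ihD _ (by omega) _ _ rfl
  by_cases hi : b ≤ i
  · obtain ⟨i, rfl⟩ := Nat.exists_eq_add_of_le hi
    have h := Submodule.mul_mem_mul
      (Submodule.mem_span_singleton_self (R := K) (x ^ i * y ^ j)) hx
    rw [lowerMonomialSpan, Submodule.span_mul_span] at h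
    have h2 : x ^ (b + i) * y ^ j = x ^ i * y ^ j * x ^ b := by ring
    rw [h2]
    refine Submodule.span_le.2 ?_ h
    rintro _ ⟨_, rfl, _, ⟨i', j', h3, h4, rfl⟩, rfl⟩
    have h5 : x ^ i * y ^ j * (x ^ i' * y ^ j') = x ^ (i + i') * y ^ (j + j') := by ring
    change x ^ i * y ^ j * (x ^ i' * y ^ j') ∈ S
    rw [h5]
    rcases Nat.lt_or_ge (i + i' + (j + j')) D with hlt | hge
    · exact ihD _ hlt _ _ rfl
    · exact ihi (i + i') (by omega) (j + j') (by omega)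
  · exact Submodule.subset_span ⟨(⟨i, by omega⟩, ⟨j, by omega⟩), rfl⟩

/-- A form of Bézout's theorem in the affine plane. -/
theorem card_le_mul_of_mem_span {T : Finset (K × K)} {a b : ℕ} {x y : T → K}
    (hxdef : x = fun t => t.1.1) (hydef : y = fun t => t.1.2)
    (hy : y ^ a ∈ Submodule.span K {f | ∃ i j, i + j < a ∧ f = x ^ i * y ^ j})
    (hx : x ^ b ∈ lowerMonomialSpan K x y b) : T.card ≤ b * a := by
  classical
  set S := Submodule.span K
      (Set.range fun ij : Fin b × Fin a => x ^ (ij.1 : ℕ) * y ^ (ij.2 : ℕ)) with hS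
  have hmon : ∀ i j, x ^ i * y ^ j ∈ S := monomial_mem_span_box hy hx
  have hpoly : ∀ P R : Polynomial K, Polynomial.aeval x P * Polynomial.aeval y R ∈ S := by
    intro P R
    rw [Polynomial.aeval_eq_sum_range, Polynomial.aeval_eq_sum_range, Finset.sum_mul_sum]
    refine Submodule.sum_mem _ fun i _ => Submodule.sum_mem _ fun j _ => ?_
    rw [smul_mul_smul_comm]
    exact Submodule.smul_mem _ _ (hmon i j)
  -- Lagrange interpolation: a product of linear factors in `x` and in `y` vanishes at all points of
  -- `T` except `t`. Hence the monomials span all functions on `T`, a space of dimension `T.card`.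
  have hsingle : ∀ t : T, ∃ c : K, c ≠ 0 ∧ Pi.single t c ∈ S := by
    intro t
    set P : Polynomial K := ∏ s ∈ (T.image Prod.fst).erase t.1.1,
      (Polynomial.X - Polynomial.C s)
    set R : Polynomial K := ∏ s ∈ (T.image Prod.snd).erase t.1.2,
      (Polynomial.X - Polynomial.C s)
    refine ⟨P.eval t.1.1 * R.eval t.1.2, ?_, ?_⟩
    · simp only [P, R, Polynomial.eval_prod, Polynomial.eval_sub, Polynomial.eval_X,
        Polynomial.eval_C]
      refine mul_ne_zero (Finset.prod_ne_zero_iff.2 fun s hs => ?_)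
        (Finset.prod_ne_zero_iff.2 fun s hs => ?_)
      · exact sub_ne_zero.2 (Finset.ne_of_mem_erase hs).symm
      · exact sub_ne_zero.2 (Finset.ne_of_mem_erase hs).symm
    · convert hpoly P R using 1
      funext s
      have hs : (Polynomial.aeval x P * Polynomial.aeval y R) s
          = P.eval s.1.1 * R.eval s.1.2 := by
        rw [Pi.mul_apply, hxdef, hydef]
        congr 1
        · simp
        · simp
      rw [hs]
      by_cases hst : s = t
      · subst hst; simp
      rw [Pi.single_eq_of_ne hst]
      symm
      by_cases h1 : s.1.1 = t.1.1
      · have h2 : s.1.2 ≠ t.1.2 := fun h2 => hst (Subtype.ext (Prod.ext h1 h2))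
        refine mul_eq_zero_of_right _ ?_
        simp only [R, Polynomial.eval_prod]
        exact Finset.prod_eq_zero (i := s.1.2) (Finset.mem_erase.2
          ⟨h2, Finset.mem_image_of_mem _ s.2⟩) (by simp)
      · refine mul_eq_zero_of_left ?_ _
        simp only [P, Polynomial.eval_prod]
        exact Finset.prod_eq_zero (i := s.1.1) (Finset.mem_erase.2
          ⟨h1, Finset.mem_image_of_mem _ s.2⟩) (by simp)
  have htop : S = ⊤ := by
    rw [eq_top_iff]
    intro f _
    rw [← Finset.univ_sum_single f]
    refine Submodule.sum_mem _ fun t _ => ?_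
    obtain ⟨c, hc, hcS⟩ := hsingle t
    have := Submodule.smul_mem _ (f t / c) hcS
    rwa [← Pi.single_smul, smul_eq_mul, div_mul_cancel₀ _ hc] at this
  have h := finrank_range_le_card (R := K)
    (fun ij : Fin b × Fin a => x ^ (ij.1 : ℕ) * y ^ (ij.2 : ℕ))
  rw [Set.finrank, ← hS, htop, finrank_top, Module.finrank_fintype_fun_eq_card] at h
  simpa using h

end PlaneBezout

/-! ### Hermitian forms: isotropy, orthonormal families and normal form. -/

section HermitianForm

variable {K ι : Type*} [Field K] [Fintype ι]

/-- The sesquilinear form `xᵀ H y^(q)`. -/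
def herm (q : ℕ) (H : Matrix ι ι K) (x y : ι → K) : K :=
  ∑ i, ∑ j, H i j * x i * y j ^ q

theorem eval_hermitianPoly (q : ℕ) (H : Matrix ι ι K) (x : ι → K) :
    MvPolynomial.eval x (hermitianPoly q H) = herm q H x x := by
  simp [hermitianPoly, herm]

/-- The form `xᵀ H y^(q)` as a linear form in `x`. -/
def hermLin (q : ℕ) (H : Matrix ι ι K) (y : ι → K) : (ι → K) →ₗ[K] K where
  toFun x := herm q H x y
  map_add' x z := by
    simp only [herm, Pi.add_apply, ← Finset.sum_add_distrib]
    exact Finset.sum_congr rfl fun i _ => Finset.sum_congr rfl fun j _ => by ring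
  map_smul' c x := by
    simp only [herm, Pi.smul_apply, smul_eq_mul, RingHom.id_apply, Finset.mul_sum]
    exact Finset.sum_congr rfl fun i _ => Finset.sum_congr rfl fun j _ => by ring

theorem hermLin_apply (q : ℕ) (H : Matrix ι ι K) (x y : ι → K) :
    hermLin q H y x = herm q H x y := rfl

theorem herm_add_left (q : ℕ) (H : Matrix ι ι K) (x z y : ι → K) :
    herm q H (x + z) y = herm q H x y + herm q H z y :=
  (hermLin q H y).map_add x z

theorem herm_sub_left (q : ℕ) (H : Matrix ι ι K) (x z y : ι → K) :
    herm q H (x - z) y = herm q H x y - herm q H z y :=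
  (hermLin q H y).map_sub x z

theorem herm_smul_left (q : ℕ) (H : Matrix ι ι K) (c : K) (x y : ι → K) :
    herm q H (c • x) y = c * herm q H x y :=
  (hermLin q H y).map_smul c x

theorem herm_sum_left (q : ℕ) (H : Matrix ι ι K) {κ : Type*} (s : Finset κ) (f : κ → ι → K)
    (y : ι → K) : herm q H (∑ k ∈ s, f k) y = ∑ k ∈ s, herm q H (f k) y :=
  map_sum (hermLin q H y) f s

theorem herm_smul_right (q : ℕ) (H : Matrix ι ι K) (c : K) (x y : ι → K) :
    herm q H x (c • y) = c ^ q * herm q H x y := by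
  simp only [herm, Pi.smul_apply, smul_eq_mul, Finset.mul_sum]
  exact Finset.sum_congr rfl fun i _ => Finset.sum_congr rfl fun j _ => by ring

/-- The radical of the form. -/
def hermRadical (H : Matrix ι ι K) : Submodule K (ι → K) :=
  LinearMap.ker H.transpose.mulVecLin

theorem finrank_hermRadical_add_rank (H : Matrix ι ι K) :
    Module.finrank K (hermRadical H) + H.rank = Fintype.card ι := by
  classical
  rw [← Matrix.rank_transpose, Matrix.rank, add_comm, hermRadical,
    LinearMap.finrank_range_add_finrank_ker, Module.finrank_fintype_fun_eq_card]

variable [Fintype K] {q : ℕ} {H : Matrix ι ι K}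

theorem herm_add_right (hq : Fintype.card K = q ^ 2) (x y z : ι → K) :
    herm q H x (y + z) = herm q H x y + herm q H x z := by
  simp only [herm, Pi.add_apply, ← Finset.sum_add_distrib, add_pow_of_card_eq_sq hq]
  exact Finset.sum_congr rfl fun i _ => Finset.sum_congr rfl fun j _ => by ring

theorem herm_symm (hq : Fintype.card K = q ^ 2) (hH : IsHermitianMatrix q H) (x y : ι → K) :
    herm q H y x = herm q H x y ^ q := by
  simp only [herm, sum_pow_of_card_eq_sq hq, mul_pow, pow_pow_of_card_eq_sq hq]
  rw [Finset.sum_comm]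
  refine Finset.sum_congr rfl fun i _ => Finset.sum_congr rfl fun j _ => ?_
  have : H j i = H i j ^ q := congrFun (congrFun hH.2 i) j
  rw [this]
  ring

theorem herm_eq_zero_symm (hq : Fintype.card K = q ^ 2) (hH : IsHermitianMatrix q H)
    {x y : ι → K} (h : herm q H x y = 0) : herm q H y x = 0 := by
  have := two_le_of_card_eq_sq hq
  rw [herm_symm hq hH, h, zero_pow (by omega)]

theorem herm_self_pow (hq : Fintype.card K = q ^ 2) (hH : IsHermitianMatrix q H)
    (x : ι → K) : herm q H x x ^ q = herm q H x x := (herm_symm hq hH x x).symm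

theorem mem_hermRadical (hq : Fintype.card K = q ^ 2) {x : ι → K} :
    x ∈ hermRadical H ↔ ∀ y, herm q H x y = 0 := by
  classical
  have h2 := two_le_of_card_eq_sq hq
  have key : ∀ y, herm q H x y = ∑ j, H.transpose.mulVec x j * y j ^ q := by
    intro y
    simp only [herm, Matrix.mulVec, dotProduct, Matrix.transpose_apply, Finset.sum_mul]
    exact Finset.sum_comm
  rw [hermRadical, LinearMap.mem_ker, Matrix.mulVecLin_apply]
  constructor
  · intro h y
    rw [key, h]
    simp
  · intro h
    funext j
    have := h (Pi.single j 1)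
    rw [key, Finset.sum_eq_single j] at this
    · simpa using this
    · intro i _ hij
      rw [Pi.single_eq_of_ne hij, zero_pow (by omega), mul_zero]
    · simp

/-- A subspace of isotropic vectors is totally isotropic. -/
theorem herm_eq_zero_of_isotropic (hq : Fintype.card K = q ^ 2) (hH : IsHermitianMatrix q H)
    (W : Submodule K (ι → K)) (hW : ∀ w ∈ W, herm q H w w = 0) {w w' : ι → K} (hw : w ∈ W)
    (hw' : w' ∈ W) : herm q H w w' = 0 := by
  obtain ⟨z, hz⟩ := exists_add_pow_ne_zero hq
  by_contra ha
  apply hz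
  set a := herm q H w w' with haa
  -- The scalar is chosen so that the two cross terms become `z` and `z ^ q`, whose sum is nonzero.
  have h := hW (w + (z / a) ^ q • w') (W.add_mem hw (W.smul_mem _ hw'))
  rw [herm_add_left, herm_add_right hq, herm_add_right hq, herm_smul_left, herm_smul_left,
    herm_smul_right, herm_smul_right, hW w hw, hW w' hw', herm_symm hq hH w w', ← haa,
    pow_pow_of_card_eq_sq hq, div_mul_cancel₀ _ ha, ← mul_pow, div_mul_cancel₀ _ ha] at h
  simpa using h

/-- In a non-degenerate Hermitian space of dimension at least three, the orthogonal space of a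
nonzero vector is not totally isotropic. -/
theorem exists_perp_anisotropic (hq : Fintype.card K = q ^ 2) (hH : IsHermitianMatrix q H)
    (hr : H.rank = Fintype.card ι) (hι : 3 ≤ Fintype.card ι) {v : ι → K} (hv : v ≠ 0) :
    ∃ w, herm q H w v = 0 ∧ herm q H w w ≠ 0 := by
  have hrad : hermRadical H = ⊥ := by
    have := finrank_hermRadical_add_rank H
    exact Submodule.finrank_eq_zero.1 (by omega)
  have hnd : ∀ x, (∀ y, herm q H y x = 0) → x = 0 := by
    intro x hx
    rw [← Submodule.mem_bot K, ← hrad, mem_hermRadical hq]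
    exact fun y => herm_eq_zero_symm hq hH (hx y)
  by_contra! hcon
  set W := LinearMap.ker (hermLin q H v) with hWdef
  have hmem : ∀ w, w ∈ W ↔ herm q H w v = 0 := fun w => by
    rw [hWdef, LinearMap.mem_ker, hermLin_apply]
  have hW : ∀ w ∈ W, ∀ w' ∈ W, herm q H w w' = 0 := fun w hw w' hw' =>
    herm_eq_zero_of_isotropic hq hH W (fun w hw => hcon w ((hmem w).1 hw)) hw hw'
  obtain ⟨z, hz⟩ : ∃ z, herm q H z v ≠ 0 := by
    by_contra! h
    exact hv (hnd v h)
  -- The hyperplane `W = v^⊥` is totally isotropic, so it lies in `W^⊥`, which is the line through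
  -- `v`. This is impossible for dimension at least three.
  have hle : W ≤ Submodule.span K {v} := by
    intro w hw
    rw [Submodule.mem_span_singleton]
    set c := herm q H z w / herm q H z v with hc
    refine ⟨c ^ q, ?_⟩
    have h0 : c ^ q • v + (-1 : K) • w = 0 := by
      refine hnd _ fun x => ?_
      have hx : x - (herm q H x v / herm q H z v) • z ∈ W := by
        rw [hmem, herm_sub_left, herm_smul_left, div_mul_cancel₀ _ hz, sub_self]
      have h1 := hW _ hx w hw
      rw [herm_sub_left, herm_smul_left, sub_eq_zero] at h1
      rw [herm_add_right hq, herm_smul_right, herm_smul_right, pow_pow_of_card_eq_sq hq, h1,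
        neg_pow_of_card_eq_sq hq, one_pow, hc]
      ring
    rw [neg_one_smul, ← sub_eq_add_neg, sub_eq_zero] at h0
    exact h0
  have h1 := (Submodule.finrank_mono hle).trans (finrank_span_singleton hv).le
  have h2 := LinearMap.finrank_range_add_finrank_ker (hermLin q H v)
  have h3 := (LinearMap.range (hermLin q H v)).finrank_le
  rw [Module.finrank_self] at h3
  rw [← hWdef] at h2
  rw [Module.finrank_fintype_fun_eq_card] at h2
  omega

/-- A Hermitian form of rank `r` has an orthonormal family of `r` vectors. -/
theorem exists_orthonormal_family (hq : Fintype.card K = q ^ 2) (hH : IsHermitianMatrix q H)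
    (k : ℕ) (hk : k ≤ H.rank) :
    ∃ v : Fin k → ι → K, ∀ i j, herm q H (v i) (v j) = if i = j then 1 else 0 := by
  induction k with
  | zero => exact ⟨Fin.elim0, fun i => i.elim0⟩
  | succ k ih =>
    obtain ⟨v, hv⟩ := ih (by omega)
    set f : (ι → K) →ₗ[K] (Fin k → K) := LinearMap.pi fun i => hermLin q H (v i) with hf
    have hmem : ∀ w, w ∈ LinearMap.ker f ↔ ∀ i, herm q H w (v i) = 0 := fun w => by
      rw [LinearMap.mem_ker, funext_iff]
      rfl
    -- If the orthogonal complement of the family were totally isotropic, it would lie in the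
    -- radical by Gram–Schmidt projection. But it has codimension at most `k`, which is less than
    -- the rank.
    obtain ⟨w, hw, hww⟩ : ∃ w, w ∈ LinearMap.ker f ∧ herm q H w w ≠ 0 := by
      by_contra! hcon
      have hle : LinearMap.ker f ≤ hermRadical H := by
        intro w hw
        rw [mem_hermRadical hq]
        intro x
        refine herm_eq_zero_symm hq hH ?_
        have hx : x - ∑ i, herm q H x (v i) • v i ∈ LinearMap.ker f := by
          rw [hmem]
          intro j
          rw [herm_sub_left, herm_sum_left]
          simp [herm_smul_left, hv]
        have h1 := herm_eq_zero_of_isotropic hq hH _ hcon hx hw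
        rw [herm_sub_left, herm_sum_left, Finset.sum_eq_zero, sub_zero] at h1
        · exact h1
        · intro i _
          rw [herm_smul_left, herm_eq_zero_symm hq hH ((hmem w).1 hw i), mul_zero]
      have h1 := Submodule.finrank_mono hle
      have h2 := LinearMap.finrank_range_add_finrank_ker f
      have h3 := (LinearMap.range f).finrank_le
      have h4 := finrank_hermRadical_add_rank H
      rw [Module.finrank_fintype_fun_eq_card] at h2 h3
      rw [Fintype.card_fin] at h3
      omega
    -- The value `herm q H w w` is fixed by conjugation, so its inverse is a norm and `w` can be
    -- scaled to length one.
    obtain ⟨t, ht⟩ := exists_pow_succ_eq hq (inv_ne_zero hww)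
      (by rw [inv_pow, herm_self_pow hq hH])
    have hw0 := (hmem w).1 hw
    have hw1 : ∀ i, herm q H (v i) w = 0 := fun i => herm_eq_zero_symm hq hH (hw0 i)
    refine ⟨Fin.cons (t • w) v, fun i j => ?_⟩
    refine Fin.cases ?_ (fun i => ?_) i <;> refine Fin.cases ?_ (fun j => ?_) j
    · simp only [Fin.cons_zero, herm_smul_left, herm_smul_right, if_true]
      rw [← mul_assoc, ← pow_succ, ht, inv_mul_cancel₀ hww]
    · simp [herm_smul_left, hw0, (Fin.succ_ne_zero _).symm]
    · simp [herm_smul_right, hw1]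
    · simp [hv]

theorem herm_orthonormal_sum (hq : Fintype.card K = q ^ 2) {κ : Type*} [Fintype κ]
    [DecidableEq κ] (hH : IsHermitianMatrix q H) {v : κ → ι → K}
    (hv : ∀ i j, herm q H (v i) (v j) = if i = j then 1 else 0) {e : ι → K}
    (he : e ∈ hermRadical H) (c : κ → K) (t : K) :
    (∀ j, herm q H (t • e + ∑ i, c i • v i) (v j) = c j) ∧
      herm q H (t • e + ∑ i, c i • v i) (t • e + ∑ i, c i • v i) = ∑ i, c i ^ (q + 1) := by
  have h0 := (mem_hermRadical hq).1 he
  have h1 : ∀ j, herm q H (t • e + ∑ i, c i • v i) (v j) = c j := by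
    intro j
    rw [herm_add_left, herm_smul_left, h0, herm_sum_left]
    simp [herm_smul_left, hv]
  refine ⟨h1, ?_⟩
  conv_lhs => rw [herm_add_left, herm_smul_left, h0, herm_sum_left, mul_zero, zero_add]
  refine Finset.sum_congr rfl fun i _ => ?_
  rw [herm_smul_left, herm_symm hq hH (t • e + ∑ i, c i • v i) (v i), h1, pow_succ']

/-- A Hermitian form of corank one is the pullback of any non-degenerate Hermitian form in one
dimension less. -/
theorem exists_linearEquiv_cone {n : ℕ} (hq : Fintype.card K = q ^ 2)
    {H : Matrix (Fin (n + 1)) (Fin (n + 1)) K} (hH : IsHermitianMatrix q H) (hHr : H.rank = n)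
    {U : Matrix (Fin n) (Fin n) K} (hU : IsHermitianMatrix q U) (hUr : U.rank = n) :
    ∃ Φ : (Fin (n + 1) → K) ≃ₗ[K] (Fin (n + 1) → K), ∀ (t : K) (x : Fin n → K),
      herm q H (Φ (Fin.cons t x)) (Φ (Fin.cons t x)) = herm q U x x := by
  obtain ⟨u, hu⟩ := exists_orthonormal_family hq hU n hUr.ge
  obtain ⟨v, hv⟩ := exists_orthonormal_family hq hH n hHr.ge
  obtain ⟨e, he, he0⟩ : ∃ e ∈ hermRadical H, e ≠ 0 := by
    have := finrank_hermRadical_add_rank H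
    rw [hHr, Fintype.card_fin] at this
    refine (Submodule.ne_bot_iff _).1 fun h => ?_
    rw [h, finrank_bot] at this
    omega
  have hu' := fun c => herm_orthonormal_sum hq hU hu (Submodule.zero_mem _) c 0
  simp only [smul_zero, zero_add] at hu'
  let f : (Fin n → K) →ₗ[K] (Fin n → K) := Fintype.linearCombination K u
  have hf : ∀ c, f c = ∑ i, c i • u i := fun c => rfl
  have hfinj : Function.Injective f := by
    intro c c' h
    funext j
    rw [← (hu' c).1 j, ← (hu' c').1 j, ← hf, ← hf, h]
  let F := LinearEquiv.ofInjectiveEndo f hfinj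
  -- The first coordinate runs along the radical; the others are coordinates with respect to `u`,
  -- reused with respect to `v`. Both forms then equal the sum of the `c i ^ (q + 1)`.
  let g : (Fin (n + 1) → K) →ₗ[K] (Fin (n + 1) → K) :=
    (LinearMap.proj 0 : (Fin (n + 1) → K) →ₗ[K] K).smulRight e +
      Fintype.linearCombination K v ∘ₗ F.symm.toLinearMap ∘ₗ LinearMap.funLeft K K Fin.succ
  have hg : ∀ t x, g (Fin.cons t x) = t • e + ∑ i, F.symm x i • v i := by
    intro t x
    rfl
  have hginj : Function.Injective g := by
    rw [← LinearMap.ker_eq_bot, LinearMap.ker_eq_bot']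
    intro y hy
    rw [← Fin.cons_self_tail y, hg] at hy
    have h1 : ∀ j, F.symm (Fin.tail y) j = 0 := by
      intro j
      rw [← (herm_orthonormal_sum hq hH hv he (F.symm (Fin.tail y)) (y 0)).1 j, hy]
      exact (hermLin q H (v j)).map_zero
    have h2 : Fin.tail y = 0 := by
      rw [← F.symm.map_eq_zero_iff]
      exact funext h1
    have h3 : y 0 = 0 := by
      rw [h2] at hy
      simpa [he0] using hy
    rw [← Fin.cons_self_tail y, h2, h3]
    funext i
    exact Fin.cases rfl (fun _ => rfl) i
  refine ⟨LinearEquiv.ofInjectiveEndo g hginj, fun t x => ?_⟩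
  rw [LinearEquiv.coe_ofInjectiveEndo, hg, (herm_orthonormal_sum hq hH hv he _ t).2,
    ← (hu' _).2, ← hf]
  have : f (F.symm x) = x := F.apply_symm_apply x
  rw [this]

end HermitianForm

/-! ### Counting vectors over projective points and along translates. -/

section Counting

/-- The number of vectors in the affine cone over a set of projective points. -/
theorem card_cone_eq {K V : Type*} [Field K] [Fintype K] [AddCommGroup V] [Module K V]
    [Fintype V] [DecidableEq V] (S : Set (ℙ K V)) (C : Finset V) (h0 : (0 : V) ∈ C)
    (hC : ∀ (v : V) (hv : v ≠ 0), v ∈ C ↔ Projectivization.mk K v hv ∈ S) :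
    C.card = 1 + (Fintype.card K - 1) * S.ncard := by
  classical
  have hfin : S.Finite := Set.toFinite S
  rw [← Finset.card_erase_add_one h0, Set.ncard_eq_toFinset_card S hfin, add_comm,
    ← Fintype.card_units, mul_comm, ← Finset.card_univ (α := Kˣ), ← Finset.card_product]
  congr 1
  have hne : ∀ (u : Kˣ) (P : ℙ K V), u • P.rep ≠ 0 := fun u P =>
    (smul_ne_zero_iff_ne u).2 P.rep_nonzero
  have hmk : ∀ (u : Kˣ) (P : ℙ K V), Projectivization.mk K (u • P.rep) (hne u P) = P := by
    intro u P
    conv_rhs => rw [← P.mk_rep]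
    rw [Projectivization.mk_eq_mk_iff]
    exact ⟨u, rfl⟩
  symm
  refine Finset.card_bij (fun x _ => x.2 • x.1.rep) ?_ ?_ ?_
  · rintro ⟨P, u⟩ h
    have hP : P ∈ S := by simpa using h
    rw [Finset.mem_erase, hC _ (hne u P), hmk]
    exact ⟨hne u P, hP⟩
  · rintro ⟨P, u⟩ _ ⟨P', u'⟩ _ h
    have hPP : P = P' := by
      rw [← hmk u P, ← hmk u' P']
      congr 1
    subst hPP
    have h2 : (u : K) • P.rep = (u' : K) • P.rep := h
    exact Prod.ext rfl (Units.ext (smul_left_injective K P.rep_nonzero h2))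
  · intro v hv
    rw [Finset.mem_erase] at hv
    obtain ⟨a, ha⟩ := Projectivization.exists_smul_eq_mk_rep K v hv.1
    refine ⟨(Projectivization.mk K v hv.1, a⁻¹), ?_, ?_⟩
    · simpa using (hC v hv.1).1 hv.2
    · simp [← ha]

/-- Counting along the translates of a family of vectors. -/
theorem card_mul_card_le {E V : Type*} [Fintype E] [AddCommGroup V] [Fintype V] [DecidableEq V]
    (f : E → V) (Z D : Finset V) (c : ℕ) (hD : ∀ u e, u + f e ∈ Z → u ∈ D)
    (hc : ∀ u ∈ D, (Finset.univ.filter fun e => u + f e ∈ Z).card ≤ c) :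
    Fintype.card E * Z.card ≤ c * D.card := by
  have h1 : ∑ e : E, (D.filter fun u => u + f e ∈ Z).card
      = ∑ u ∈ D, (Finset.univ.filter fun e => u + f e ∈ Z).card := by
    simp only [Finset.card_filter]
    exact Finset.sum_comm
  -- For fixed `e`, translation by `f e` is a bijection onto `Z`, since `hD` puts every base point
  -- into `D`.
  have h2 : ∀ e : E, (D.filter fun u => u + f e ∈ Z).card = Z.card := by
    intro e
    refine Finset.card_bij (fun u _ => u + f e) (fun u hu => (Finset.mem_filter.1 hu).2)
      (fun u _ u' _ h => add_right_cancel h) fun z hz => ⟨z - f e, ?_, by simp⟩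
    have : z - f e + f e ∈ Z := by simpa using hz
    exact Finset.mem_filter.2 ⟨hD _ e this, this⟩
  simp only [h2, Finset.sum_const, Finset.card_univ, smul_eq_mul] at h1
  rw [h1, mul_comm c]
  exact (Finset.sum_le_card_nsmul _ _ _ hc).trans_eq (smul_eq_mul _ _)

theorem card_zeros_le_natDegree {K : Type*} [Field K] [Fintype K] [DecidableEq K]
    {P : Polynomial K} (hP : P ≠ 0) :
    (Finset.univ.filter fun t => P.eval t = 0).card ≤ P.natDegree := by
  refine le_trans (Finset.card_le_card (t := P.roots.toFinset) fun t ht => ?_)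
    ((Multiset.toFinset_card_le _).trans P.card_roots')
  simpa [hP] using ht

end Counting

/-! ### Isotropic vectors, and those on a hypersurface of low degree. -/

section HermitianCounting

variable {K ι : Type*} [Field K] [Fintype ι] [Fintype K] {q : ℕ} {H : Matrix ι ι K}

theorem herm_line (hq : Fintype.card K = q ^ 2) (u w : ι → K) (t : K) :
    herm q H (u + t • w) (u + t • w) = herm q H u u + herm q H w u * t + herm q H u w * t ^ q +
      herm q H w w * t ^ (q + 1) := by
  rw [herm_add_left, herm_add_right hq, herm_add_right hq, herm_smul_left, herm_smul_left,
    herm_smul_right, herm_smul_right]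
  ring

theorem card_isotropic_on_line_le [DecidableEq K] (hq : Fintype.card K = q ^ 2)
    (u w : ι → K) (h : herm q H w w ≠ 0) :
    (Finset.univ.filter fun t : K => herm q H (u + t • w) (u + t • w) = 0).card ≤ q + 1 := by
  have h2 := two_le_of_card_eq_sq hq
  set P : Polynomial K := Polynomial.C (herm q H u u) +
    Polynomial.C (herm q H w u) * Polynomial.X + Polynomial.C (herm q H u w) * Polynomial.X ^ q +
    Polynomial.C (herm q H w w) * Polynomial.X ^ (q + 1) with hP
  have hcoeff : P.coeff (q + 1) ≠ 0 := by
    simp [hP, Polynomial.coeff_C, Polynomial.coeff_X_pow, h,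
      show q ≠ 0 by omega]
  have hdeg : P.natDegree ≤ q + 1 := by
    rw [hP]
    compute_degree
  have hP0 : P ≠ 0 := fun h0 => hcoeff (by rw [h0, Polynomial.coeff_zero])
  refine le_trans (le_of_eq ?_) ((card_zeros_le_natDegree hP0).trans hdeg)
  congr 1
  ext t
  simp [herm_line hq, hP]

/-- In an isotropic direction the term in `t ^ (q + 1)` disappears, and `t ^ q` has the coefficient
`herm q H u p`. -/
theorem card_isotropic_on_line_le_of_isotropic [DecidableEq K] (hq : Fintype.card K = q ^ 2)
    {u p : ι → K} (hp : herm q H p p = 0) (h : herm q H u p ≠ 0) :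
    (Finset.univ.filter fun t : K => herm q H (u + t • p) (u + t • p) = 0).card ≤ q := by
  have h2 := two_le_of_card_eq_sq hq
  set P : Polynomial K := Polynomial.C (herm q H u u) +
    Polynomial.C (herm q H p u) * Polynomial.X +
    Polynomial.C (herm q H u p) * Polynomial.X ^ q with hP
  have hcoeff : P.coeff q ≠ 0 := by
    simp [hP, Polynomial.coeff_X, Polynomial.coeff_C, h,
      show q ≠ 0 by omega, show 1 ≠ q by omega]
  have hdeg : P.natDegree ≤ q := by
    rw [hP]
    compute_degree
    omega
  have hP0 : P ≠ 0 := fun h0 => hcoeff (by rw [h0, Polynomial.coeff_zero])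
  refine le_trans (le_of_eq ?_) ((card_zeros_le_natDegree hP0).trans hdeg)
  congr 1
  ext t
  simp [herm_line hq, hP, hp]

/-- A form of degree at most `q` that vanishes on a non-degenerate Hermitian variety of positive
dimension is zero. -/
theorem exists_isotropic_eval_ne_zero (hq : Fintype.card K = q ^ 2) (hH : IsHermitianMatrix q H)
    (hr : H.rank = Fintype.card ι) (hι : 3 ≤ Fintype.card ι) {G : MvPolynomial ι K} {k : ℕ}
    (hG : G.IsHomogeneous k) (hG0 : G ≠ 0) (hk : k ≤ q) :
    ∃ p, herm q H p p = 0 ∧ MvPolynomial.eval p G ≠ 0 := by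
  classical
  have h2 := two_le_of_card_eq_sq hq
  by_contra! hcon
  refine hG0 (hG.eq_zero_of_forall_eval_eq_zero_of_le_card (fun v => ?_) ?_)
  swap
  · rw [Cardinal.mk_fintype, hq]
    exact_mod_cast hk.trans (by nlinarith)
  by_cases hvv : herm q H v v = 0
  · exact hcon v hvv
  have hv0 : v ≠ 0 := by
    rintro rfl
    exact hvv ((hermLin q H 0).map_zero)
  obtain ⟨w, hwv, hww⟩ := exists_perp_anisotropic hq hH hr hι hv0
  have hvw := herm_eq_zero_symm hq hH hwv
  -- Since `v ⟂ w`, the vector `v + t • w` is isotropic exactly when `t ^ (q + 1) = a`. These are `q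
  -- + 1` values, too many for a nonzero polynomial of degree at most `q`, so `G` vanishes at `v`
  -- too.
  set a := -herm q H v v / herm q H w w with ha
  have hcard := card_norm_fiber hq (a := a) (div_ne_zero (neg_ne_zero.2 hvv) hww)
    (by rw [ha, div_pow, neg_pow_of_card_eq_sq hq, herm_self_pow hq hH, herm_self_pow hq hH])
  set P : Polynomial K := MvPolynomial.aeval
    (fun i => Polynomial.C (w i) * Polynomial.X + Polynomial.C (v i)) G with hP
  have heval : ∀ t, P.eval t = MvPolynomial.eval (v + t • w) G := by
    intro t
    rw [hP, ← Polynomial.coe_evalRingHom, MvPolynomial.aeval_def, MvPolynomial.hom_eval₂,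
      MvPolynomial.eval, MvPolynomial.coe_eval₂Hom]
    congr 1
    · ext; simp
    · funext i
      simp
      ring
  have hdeg : P.natDegree ≤ k * 1 :=
    MvPolynomial.aeval_natDegree_le G hG.totalDegree_le _ fun i => Polynomial.natDegree_linear_le
  have hP0 : P = 0 := by
    refine Polynomial.eq_zero_of_natDegree_lt_card_of_eval_eq_zero' P
      (Finset.univ.filter fun t : K => t ^ (q + 1) = a) (fun t ht => ?_) (by rw [hcard]; omega)
    rw [heval]
    refine hcon _ ?_
    have ht' : t ^ (q + 1) = a := (Finset.mem_filter.1 ht).2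
    rw [herm_line hq, hvw, hwv, ht', ha, mul_div_cancel₀ _ hww]
    ring
  have := heval 0
  rw [hP0, zero_smul, add_zero, Polynomial.eval_zero] at this
  exact this.symm

theorem ne_zero_of_eval_ne_zero {K ι : Type*} [Field K] {G : MvPolynomial ι K} {k : ℕ}
    (hG : G.IsHomogeneous k) (hk : 1 ≤ k) {p : ι → K} (hp : MvPolynomial.eval p G ≠ 0) :
    p ≠ 0 := by
  rintro rfl
  apply hp
  rw [MvPolynomial.eval_zero, MvPolynomial.constantCoeff_eq]
  exact hG.coeff_eq_zero (by simp; omega)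

/-- The affine version of the bound on the number of points that a non-degenerate Hermitian
variety shares with a hypersurface of degree `k ≤ q`. -/
theorem card_isotropic_zeros_le [DecidableEq K] [DecidableEq ι] (hq : Fintype.card K = q ^ 2)
    (hH : IsHermitianMatrix q H)
    (hr : H.rank = Fintype.card ι) (hι : 3 ≤ Fintype.card ι) {G : MvPolynomial ι K} {k : ℕ}
    (hG : G.IsHomogeneous k) (hG0 : G ≠ 0) (hk1 : 1 ≤ k) (hk : k ≤ q) :
    (Finset.univ.filter fun x => herm q H x x = 0 ∧ MvPolynomial.eval x G = 0).card ≤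
      k * (q + 1) * (q ^ 2) ^ (Fintype.card ι - 2) := by
  classical
  obtain ⟨p, hpp, hGp⟩ := exists_isotropic_eval_ne_zero hq hH hr hι hG hG0 hk
  obtain ⟨v, hvp, hvv⟩ := exists_perp_anisotropic hq hH hr hι
    (ne_zero_of_eval_ne_zero hG hk1 hGp)
  have hpv := herm_eq_zero_symm hq hH hvp
  set Z := Finset.univ.filter fun x => herm q H x x = 0 ∧ MvPolynomial.eval x G = 0 with hZ
  have h := card_mul_card_le (fun e : K × K => e.1 • p + e.2 • v) Z Finset.univ (k * (q + 1))
    (fun _ _ _ => Finset.mem_univ _) ?_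
  · obtain ⟨m, hm⟩ : ∃ m, Fintype.card ι = m + 2 := ⟨Fintype.card ι - 2, by omega⟩
    rw [Finset.card_univ, Fintype.card_prod, Fintype.card_fun, hq, hm] at h
    rw [hm, Nat.add_sub_cancel]
    have hq0 : 0 < q ^ 2 * q ^ 2 := by
      have := two_le_of_card_eq_sq hq
      positivity
    refine Nat.le_of_mul_le_mul_left (h.trans_eq ?_) hq0
    ring
  intro u _
  set T := Finset.univ.filter fun e : K × K => u + (e.1 • p + e.2 • v) ∈ Z with hT
  set x : T → K := fun t => t.1.1 with hx
  set y : T → K := fun t => t.1.2 with hy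
  have hTZ : ∀ t : T, herm q H (u + (x t • p + y t • v)) (u + (x t • p + y t • v)) = 0 ∧
      MvPolynomial.eval (u + (x t • p + y t • v)) G = 0 := fun t => by
    have := (Finset.mem_filter.1 t.2).2
    rw [hZ, Finset.mem_filter] at this
    exact this.2
  refine card_le_mul_of_mem_span hx hy ?_ ?_
  -- As `p` is isotropic and orthogonal to `v`, the only monomial of degree `q + 1` in the Hermitian
  -- equation on the plane is `y ^ (q + 1)`.
  · set S := Submodule.span K {f | ∃ i j, i + j < q + 1 ∧ f = x ^ i * y ^ j} with hS
    have hmon : ∀ i j, i + j < q + 1 → x ^ i * y ^ j ∈ S := fun i j hij =>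
      Submodule.subset_span ⟨i, j, hij, rfl⟩
    have h2 := two_le_of_card_eq_sq hq
    have h00 : (1 : T → K) ∈ S := by simpa using hmon 0 0 (by omega)
    have h10 : x ∈ S := by simpa using hmon 1 0 (by omega)
    have h01 : y ∈ S := by simpa using hmon 0 1 (by omega)
    have hq0 : x ^ q ∈ S := by simpa using hmon q 0 (by omega)
    have h0q : y ^ q ∈ S := by simpa using hmon 0 q (by omega)
    have hmem := S.smul_mem (-(herm q H v v)⁻¹) (S.add_mem (S.add_mem (S.add_mem (S.add_mem
      (S.smul_mem (herm q H u u) h00) (S.smul_mem (herm q H p u) h10))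
      (S.smul_mem (herm q H u p) hq0)) (S.smul_mem (herm q H v u) h01))
      (S.smul_mem (herm q H u v) h0q))
    convert hmem using 1
    funext t
    have h1 := (hTZ t).1
    rw [herm_add_left, herm_add_left, herm_add_right hq, herm_add_right hq, herm_add_right hq,
      herm_add_right hq, herm_add_right hq, herm_add_right hq] at h1
    simp only [herm_smul_left, herm_smul_right, hpp, hvp, hpv, mul_zero, add_zero, zero_add] at h1
    simp only [Pi.smul_apply, Pi.add_apply, Pi.pow_apply, Pi.one_apply, smul_eq_mul]
    field_simp
    rw [pow_succ]
    linear_combination h1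
  -- The coefficient of `x ^ k` in the restriction of `G` is `G(p) ≠ 0`.
  · have hl := hasLeading_aeval hG x y u p v
    have h0 : MvPolynomial.aeval
        (fun l => algebraMap K (T → K) (u l) + p l • x + v l • y) G = 0 := by
      funext t
      have h1 := (hTZ t).2
      change Pi.evalRingHom (fun _ : T => K) t (MvPolynomial.aeval _ G) = 0
      rw [MvPolynomial.aeval_def, MvPolynomial.hom_eval₂]
      rw [MvPolynomial.eval, MvPolynomial.coe_eval₂Hom] at h1
      rw [← h1]
      congr 1
      funext l
      simp
      ring
    rw [HasLeading, h0, zero_sub, ← neg_smul] at hl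
    have := Submodule.smul_mem _ (-MvPolynomial.eval p G)⁻¹ hl
    rwa [smul_smul, inv_mul_cancel₀ (neg_ne_zero.2 hGp), one_smul] at this

/-- A bound on the number of isotropic vectors of a non-degenerate Hermitian form. -/
theorem card_isotropic_le [DecidableEq K] [DecidableEq ι] (hq : Fintype.card K = q ^ 2)
    (hH : IsHermitianMatrix q H)
    (hr : H.rank = Fintype.card ι) (hι : 3 ≤ Fintype.card ι) :
    (Finset.univ.filter fun x => herm q H x x = 0).card ≤
      (q * q ^ 2 + 1) * (q ^ 2) ^ (Fintype.card ι - 2) := by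
  have h2 := two_le_of_card_eq_sq hq
  -- A coordinate form serves only to produce a nonzero isotropic vector.
  obtain ⟨p, hp, hp1⟩ := exists_isotropic_eval_ne_zero hq hH hr hι
    (MvPolynomial.isHomogeneous_X K (Classical.choice (Fintype.card_pos_iff.1 (by omega) :
      Nonempty ι))) (MvPolynomial.X_ne_zero _) (by omega)
  have hp0 := ne_zero_of_eval_ne_zero (MvPolynomial.isHomogeneous_X K _) le_rfl hp1
  obtain ⟨w, hwp, hww⟩ := exists_perp_anisotropic hq hH hr hι hp0
  set D₀ := Finset.univ.filter fun x => herm q H x p = 0 with hD₀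
  set D₁ := Finset.univ.filter fun x => ¬ herm q H x p = 0 with hD₁
  set Z := Finset.univ.filter fun x => herm q H x x = 0 with hZ
  have hD : D₀.card + D₁.card = (q ^ 2) ^ Fintype.card ι := by
    rw [Finset.card_filter_add_card_filter_not, Finset.card_univ, Fintype.card_fun, hq]
  have hZs : (Z.filter fun x => herm q H x p = 0).card +
      (Z.filter fun x => ¬ herm q H x p = 0).card = Z.card :=
    Finset.card_filter_add_card_filter_not _
  have hD₀c : D₀.card = (q ^ 2) ^ (Fintype.card ι - 1) := by
    have hrad : hermRadical H = ⊥ := by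
      have := finrank_hermRadical_add_rank H
      exact Submodule.finrank_eq_zero.1 (by omega)
    have hne : hermLin q H p ≠ 0 := by
      intro h0
      apply hp0
      rw [← Submodule.mem_bot K, ← hrad, mem_hermRadical hq]
      exact fun y => herm_eq_zero_symm hq hH (LinearMap.congr_fun h0 y)
    have h3 := Module.Dual.finrank_ker_add_one_of_ne_zero hne
    rw [Module.finrank_fintype_fun_eq_card] at h3
    have h4 := Module.natCard_eq_pow_finrank (K := K) (V := LinearMap.ker (hermLin q H p))
    rw [Nat.card_eq_fintype_card (α := K), hq,
      show Module.finrank K (LinearMap.ker (hermLin q H p)) = Fintype.card ι - 1 by omega] at h4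
    rw [← h4]
    exact (Nat.subtype_card D₀ fun x => by
      rw [hD₀, Finset.mem_filter, LinearMap.mem_ker, hermLin_apply]
      simp).symm
  -- Inside `p^⊥`, lines in the direction `w` carry at most `q + 1` isotropic vectors; outside,
  -- lines in the direction `p` carry at most `q`. In total `q² |Z| ≤ (q+1)|D₀| + q|D₁|`.
  have hA := card_mul_card_le (fun t : K => t • w) (Z.filter fun x => herm q H x p = 0) D₀ (q + 1)
    (fun u t hu => ?_) (fun u hu => ?_)
  have hB := card_mul_card_le (fun t : K => t • p) (Z.filter fun x => ¬ herm q H x p = 0) D₁ q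
    (fun u t hu => ?_) (fun u hu => ?_)
  · obtain ⟨m, hm⟩ : ∃ m, Fintype.card ι = m + 2 := ⟨Fintype.card ι - 2, by omega⟩
    rw [hm] at hD hD₀c ⊢
    simp only [Nat.add_sub_cancel, show m + 2 - 1 = m + 1 by omega] at hD₀c ⊢
    rw [hq] at hA hB
    have hq0 : 0 < q ^ 2 := by positivity
    refine Nat.le_of_mul_le_mul_left ?_ hq0
    rw [← hZs]
    have h5 : q * D₁.card + q * D₀.card = q * (q ^ 2) ^ (m + 2) := by rw [← hD]; ring
    rw [hD₀c] at hA h5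
    have e1 : (q ^ 2) ^ (m + 1) = q ^ 2 * (q ^ 2) ^ m := pow_succ' _ _
    have e2 : (q ^ 2) ^ (m + 2) = q ^ 2 * (q ^ 2 * (q ^ 2) ^ m) := by ring
    rw [e1] at hA h5
    rw [e2] at h5
    generalize q ^ 2 = s at *
    generalize s ^ m = X at *
    linarith
  · have h3 := (Finset.mem_filter.1 hu).2
    rw [herm_add_left, herm_smul_left, hp, mul_zero, add_zero] at h3
    exact Finset.mem_filter.2 ⟨Finset.mem_univ _, h3⟩
  · refine le_trans (Finset.card_le_card ?_)
      (card_isotropic_on_line_le_of_isotropic hq hp (Finset.mem_filter.1 hu).2)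
    intro t ht
    simp only [hZ, Finset.mem_filter, Finset.mem_univ, true_and] at ht ⊢
    exact ht.1
  · have h3 := (Finset.mem_filter.1 hu).2
    rw [herm_add_left, herm_smul_left, hwp, mul_zero, add_zero] at h3
    exact Finset.mem_filter.2 ⟨Finset.mem_univ _, h3⟩
  · refine le_trans (Finset.card_le_card ?_) (card_isotropic_on_line_le hq u w hww)
    intro t ht
    simp only [hZ, Finset.mem_filter, Finset.mem_univ, true_and] at ht ⊢
    exact ht.1

end HermitianCounting

/-! ### Linear changes of variables in polynomials. -/

section LinearSubstitution

variable {K σ τ : Type*} [Field K] [Fintype σ] [DecidableEq σ]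

/-- The polynomial `F ∘ Φ` for a linear map `Φ`. -/
noncomputable def linSubst (Φ : (σ → K) →ₗ[K] (τ → K)) (F : MvPolynomial τ K) : MvPolynomial σ K :=
  MvPolynomial.aeval
    (fun i => ∑ j, MvPolynomial.C (Φ (Pi.single j 1) i) * MvPolynomial.X j) F

theorem linSubst_isHomogeneous (Φ : (σ → K) →ₗ[K] (τ → K)) {F : MvPolynomial τ K} {d : ℕ}
    (hF : F.IsHomogeneous d) : (linSubst Φ F).IsHomogeneous d := by
  have h := hF.aeval (S := K) (n := 1)
    (fun i => ∑ j : σ, MvPolynomial.C (Φ (Pi.single j 1) i) * MvPolynomial.X j)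
    fun i => MvPolynomial.IsHomogeneous.sum _ _ _ fun j _ =>
      MvPolynomial.isHomogeneous_C_mul_X _ _
  rwa [one_mul] at h

theorem eval_linSubst (Φ : (σ → K) →ₗ[K] (τ → K)) (F : MvPolynomial τ K) (x : σ → K) :
    MvPolynomial.eval x (linSubst Φ F) = MvPolynomial.eval (Φ x) F := by
  rw [linSubst, MvPolynomial.aeval_def, MvPolynomial.hom_eval₂, MvPolynomial.eval,
    MvPolynomial.coe_eval₂Hom, ← MvPolynomial.eval]
  congr 1
  · ext; simp
  · funext i
    change MvPolynomial.eval x (∑ j, MvPolynomial.C (Φ (Pi.single j 1) i) * MvPolynomial.X j) = _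
    rw [map_sum]
    conv_rhs => rw [← Finset.univ_sum_single x, map_sum, Finset.sum_apply]
    refine Finset.sum_congr rfl fun j _ => ?_
    have : Pi.single j (x j) = x j • (Pi.single j 1 : σ → K) := by
      rw [← Pi.single_smul, smul_eq_mul, mul_one]
    rw [this, map_smul]
    simp [mul_comm]

end LinearSubstitution

/-! ### Fibre count over the base of the cone and the final estimate. -/

section Main

/-- Counting the zeros of a polynomial fibrewise over the zeros of its leading coefficient with
respect to the first variable. -/
theorem card_zeros_over_le {K : Type*} [Field K] [Fintype K] [DecidableEq K] {n : ℕ}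
    (F : MvPolynomial (Fin (n + 1)) K) (S : Finset (Fin n → K)) :
    (Finset.univ.filter fun y : Fin (n + 1) → K =>
      Fin.tail y ∈ S ∧ MvPolynomial.eval y F = 0).card ≤
    (MvPolynomial.finSuccEquiv K n F).natDegree *
      (S.card - (S.filter fun x =>
        MvPolynomial.eval x (MvPolynomial.finSuccEquiv K n F).leadingCoeff = 0).card) +
      Fintype.card K * (S.filter fun x =>
        MvPolynomial.eval x (MvPolynomial.finSuccEquiv K n F).leadingCoeff = 0).card := by
  set P := MvPolynomial.finSuccEquiv K n F with hP
  set C := Finset.univ.filter fun y : Fin (n + 1) → K =>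
    Fin.tail y ∈ S ∧ MvPolynomial.eval y F = 0 with hC
  have hmaps : ∀ y ∈ C, Fin.tail y ∈ S := fun y hy => (Finset.mem_filter.1 hy).2.1
  rw [Finset.card_eq_sum_card_fiberwise hmaps]
  have hfib : ∀ x ∈ S, (C.filter fun y => Fin.tail y = x).card =
      (Finset.univ.filter fun t : K =>
        MvPolynomial.eval (Fin.cons t x : Fin (n + 1) → K) F = 0).card := by
    intro x hx
    refine Finset.card_bij' (fun y _ => y 0) (fun t _ => Fin.cons t x) ?_ ?_ ?_ ?_
    · intro y hy
      simp only [hC, Finset.mem_filter, Finset.mem_univ, true_and] at hy ⊢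
      rw [← hy.2, Fin.cons_self_tail]
      exact hy.1.2
    · intro t ht
      simp only [hC, Finset.mem_filter, Finset.mem_univ, true_and] at ht ⊢
      exact ⟨⟨by simpa using hx, ht⟩, by simp⟩
    · intro y hy
      simp only [hC, Finset.mem_filter, Finset.mem_univ, true_and] at hy
      rw [← hy.2, Fin.cons_self_tail]
    · intro t _
      simp
  have hneg := Finset.card_filter_add_card_filter_not (s := S)
    (fun x => MvPolynomial.eval x P.leadingCoeff = 0)
  rw [Finset.sum_congr rfl hfib, ← Finset.sum_filter_add_sum_filter_not S
    (fun x => MvPolynomial.eval x P.leadingCoeff = 0), add_comm]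
  refine add_le_add ?_ ?_
  · rw [show S.card - (S.filter fun x => MvPolynomial.eval x P.leadingCoeff = 0).card
      = (S.filter fun x => ¬ MvPolynomial.eval x P.leadingCoeff = 0).card by omega, mul_comm]
    refine (Finset.sum_le_card_nsmul _ _ P.natDegree fun x hx => ?_).trans_eq (smul_eq_mul _ _)
    have hx' := (Finset.mem_filter.1 hx).2
    have h0 : P.map (MvPolynomial.eval x) ≠ 0 := fun h => hx' (by
      rw [Polynomial.leadingCoeff, ← Polynomial.coeff_map, h, Polynomial.coeff_zero])
    simp only [MvPolynomial.eval_eq_eval_mv_eval']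
    exact (card_zeros_le_natDegree h0).trans Polynomial.natDegree_map_le
  · rw [mul_comm]
    exact (Finset.sum_le_card_nsmul _ _ (Fintype.card K) fun x _ =>
      Finset.card_le_univ _).trans_eq (smul_eq_mul _ _)

/-- Rests on `q³ + 1 ≤ (q² - 1)(q + 1)`, an equality for `q = 2`. -/
theorem le_of_affine_bound {q w X N : ℕ} (hq : 2 ≤ q) (hw : w + 1 = q ^ 2)
    (h : 1 + w * N ≤ (q * q ^ 2 + 1) * X) : N ≤ (q + 1) * X := by
  have hw0 : 0 < w := by nlinarith
  refine Nat.le_of_mul_le_mul_left (c := w) ?_ hw0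
  have h1 : q * q ^ 2 + 1 ≤ w * (q + 1) := by
    rw [← hw]
    nlinarith
  nlinarith [Nat.mul_le_mul_right X h1]

/-- The coefficient `w + 1 - e` of `Z` is positive, so `Z` may be replaced by `B`. The leftover `e -
1` is at most `(e - 1) * B` because `1 ≤ B`, so division by `w` gives `c ≤ e * N + B`. -/
theorem le_of_fiber_bound {w c e N Z B D : ℕ} (he : 1 ≤ e) (hew : e ≤ w) (hND : N ≤ D)
    (hZ : Z ≤ 1 + w * N) (hZB : Z ≤ B) (hB : 1 ≤ B)
    (h : 1 + w * c ≤ e * (1 + w * N - Z) + (w + 1) * Z) : c ≤ N + (e - 1) * D + B := by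
  obtain ⟨r, rfl⟩ : ∃ r, e = r + 1 := ⟨e - 1, by omega⟩
  obtain ⟨s, rfl⟩ : ∃ s, w = r + 1 + s := ⟨w - (r + 1), by omega⟩
  obtain ⟨y, hy⟩ := Nat.exists_eq_add_of_le hZ
  rw [hy, Nat.add_sub_cancel_left] at h
  rw [Nat.add_sub_cancel]
  refine Nat.le_of_mul_le_mul_left (c := r + 1 + s) ?_ (by omega)
  have h1 : (r + 1 + s) * N * (r + 1) + (r + 1) = (Z + y) * (r + 1) := by rw [← hy]; ring
  have h2 : (s + 1) * Z ≤ (s + 1) * B := Nat.mul_le_mul_left _ hZB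
  have h3 : r * 1 ≤ r * B := Nat.mul_le_mul_left _ hB
  have h4 : (r + 1 + s) * (r * N) ≤ (r + 1 + s) * (r * D) :=
    Nat.mul_le_mul_left _ (Nat.mul_le_mul_left _ hND)
  nlinarith

/-- The case `Z = B = 0`, excluded above by `1 ≤ B`: here the leftover `e - 1` is smaller than `w`
and is lost on division. -/
theorem le_of_fiber_bound_of_no_zeros {w c e N D : ℕ} (he : 1 ≤ e) (hew : e ≤ w) (hND : N ≤ D)
    (h : 1 + w * c ≤ e * (1 + w * N)) : c ≤ N + (e - 1) * D := by
  obtain ⟨r, rfl⟩ : ∃ r, e = r + 1 := ⟨e - 1, by omega⟩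
  rw [Nat.add_sub_cancel]
  have h4 : r * N ≤ r * D := Nat.mul_le_mul_left _ hND
  refine le_trans (Nat.lt_succ_iff.1 ?_) (Nat.add_le_add_left h4 N)
  refine Nat.lt_of_mul_lt_mul_left (a := w) ?_
  nlinarith

/-- The affine cone over the rational points that a Hermitian variety shares with a
hypersurface. -/
theorem card_affine_inter {K ι : Type*} [Field K] [Fintype K] [DecidableEq K] [Fintype ι]
    [DecidableEq ι] (q : ℕ) (H : Matrix ι ι K) {F : MvPolynomial ι K} {d : ℕ}
    (hF : F.IsHomogeneous d) (hd : 1 ≤ d) :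
    (Finset.univ.filter fun x => herm q H x x = 0 ∧ MvPolynomial.eval x F = 0).card =
      1 + (Fintype.card K - 1) * (hermitianPoints q H ∩ projZeros F).ncard := by
  refine card_cone_eq _ _ ?_ fun v hv => ?_
  · refine Finset.mem_filter.2 ⟨Finset.mem_univ _, (hermLin q H 0).map_zero, ?_⟩
    by_contra h
    exact ne_zero_of_eval_ne_zero hF hd h rfl
  · rw [Set.mem_inter_iff, hermitianPoints, mk_mem_projZeros (hermitianPoly_isHomogeneous q H),
      mk_mem_projZeros hF, eval_hermitianPoly]
    simp

theorem card_affine_hermitian {K ι : Type*} [Field K] [Fintype K] [DecidableEq K] [Fintype ι]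
    [DecidableEq ι] (q : ℕ) (H : Matrix ι ι K) :
    (Finset.univ.filter fun x => herm q H x x = 0).card =
      1 + (Fintype.card K - 1) * (hermitianPoints q H).ncard := by
  refine card_cone_eq _ _ ?_ fun v hv => ?_
  · exact Finset.mem_filter.2 ⟨Finset.mem_univ _, (hermLin q H 0).map_zero⟩
  · rw [hermitianPoints, mk_mem_projZeros (hermitianPoly_isHomogeneous q H), eval_hermitianPoly]
    simp

theorem mainTheorem2 {K : Type*} [Field K] [Finite K] (q n d : ℕ)
    (hq : Nat.card K = q ^ 2) (hn : 3 ≤ n) (hd : 1 ≤ d) (hdq : d ≤ q)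
    -- the Hermitian variety of rank `n` in `ℙⁿ`
    (H : Matrix (Fin (n + 1)) (Fin (n + 1)) K) (hH : IsHermitianMatrix q H) (hHr : H.rank = n)
    -- a non-degenerate Hermitian variety in `ℙⁿ⁻¹`
    (U : Matrix (Fin n) (Fin n) K) (hU : IsHermitianMatrix q U) (hUr : U.rank = n)
    -- a hypersurface of degree `d` in `ℙⁿ`
    (F : MvPolynomial (Fin (n + 1)) K) (hF : F.IsHomogeneous d) (hF0 : F ≠ 0) :
    (hermitianPoints q H ∩ projZeros F).ncard ≤
      max ((hermitianPoints q U).ncard + (d - 1) * (q + 1) * q ^ (2 * n - 4))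
        (1 + q ^ 2 * hermitianMax q d U) := by
  have : Fintype K := Fintype.ofFinite K
  have : DecidableEq K := Classical.decEq K
  rw [Nat.card_eq_fintype_card] at hq
  have h2 := two_le_of_card_eq_sq hq
  obtain ⟨Φ, hΦ⟩ := exists_linearEquiv_cone hq hH hHr hU hUr
  set F' := linSubst Φ.toLinearMap F with hF'
  have hF'h : F'.IsHomogeneous d := linSubst_isHomogeneous _ hF
  have hF'0 : F' ≠ 0 := by
    intro h0
    -- Since `d ≤ q ≤ |K|`, a form of degree `d` that vanishes at every vector is zero.
    refine hF0 (hF.eq_zero_of_forall_eval_eq_zero_of_le_card (fun v => ?_) ?_)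
    · have := eval_linSubst Φ.toLinearMap F (Φ.symm v)
      rw [← hF', h0] at this
      simpa using this.symm
    · rw [Cardinal.mk_fintype, hq]
      exact_mod_cast hdq.trans (by nlinarith)
  set P := MvPolynomial.finSuccEquiv K n F' with hP
  have hP0 : P ≠ 0 := (map_ne_zero_iff _ (MvPolynomial.finSuccEquiv K n).injective).2 hF'0
  set e := P.natDegree with he
  set G := P.leadingCoeff with hG
  have hG0 : G ≠ 0 := Polynomial.leadingCoeff_ne_zero.2 hP0
  have hed : e ≤ d := by
    rw [he, hP, MvPolynomial.natDegree_finSuccEquiv]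
    exact (MvPolynomial.degreeOf_le_totalDegree _ _).trans hF'h.totalDegree_le
  have hGh : G.IsHomogeneous (d - e) :=
    hF'h.finSuccEquiv_coeff_isHomogeneous e (d - e) (by omega)
  set S := Finset.univ.filter fun x => herm q U x x = 0 with hS
  obtain ⟨w, hw⟩ : ∃ w, w + 1 = q ^ 2 := ⟨q ^ 2 - 1, by
    have : 0 < q ^ 2 := by positivity
    omega⟩
  have hKw : Fintype.card K - 1 = w := by omega
  have hScard : S.card = 1 + w * (hermitianPoints q U).ncard := by
    rw [hS, card_affine_hermitian, hKw]
  have hmain := card_zeros_over_le F' S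
  have hcount : (Finset.univ.filter fun y : Fin (n + 1) → K =>
      Fin.tail y ∈ S ∧ MvPolynomial.eval y F' = 0).card =
      1 + w * (hermitianPoints q H ∩ projZeros F).ncard := by
    rw [← hKw, ← card_affine_inter q H hF hd]
    refine Finset.card_equiv Φ.toEquiv fun y => ?_
    have h1 := hΦ (y 0) (Fin.tail y)
    rw [Fin.cons_self_tail] at h1
    have h3 := eval_linSubst Φ.toLinearMap F y
    simp only [hS, Finset.mem_filter, Finset.mem_univ, true_and, LinearEquiv.coe_toEquiv]
    rw [h1, hF', h3]
    rfl
  rw [hcount, ← hP, ← he, ← hG, hScard, hq] at hmain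
  have hX : q ^ (2 * n - 4) = (q ^ 2) ^ (n - 2) := by
    rw [← pow_mul]
    congr 1
    omega
  have hcard : Fintype.card (Fin n) = n := Fintype.card_fin n
  have hNle : (hermitianPoints q U).ncard ≤ (q + 1) * (q ^ 2) ^ (n - 2) := by
    refine le_of_affine_bound h2 hw ?_
    rw [← hScard]
    have := card_isotropic_le hq hU (by rw [hUr, hcard]) (by rw [hcard]; exact hn)
    rwa [hcard] at this
  have hqw : q ≤ w := by nlinarith
  have hX0 : 0 < (q ^ 2) ^ (n - 2) := by positivity
  set Z := S.filter fun x => MvPolynomial.eval x G = 0 with hZ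
  have hZ' : Z = Finset.univ.filter fun x => herm q U x x = 0 ∧ MvPolynomial.eval x G = 0 := by
    rw [hZ, hS, Finset.filter_filter]
  have hZS : Z.card ≤ 1 + w * (hermitianPoints q U).ncard := by
    rw [← hScard]
    exact Finset.card_filter_le _ _
  rw [hX]
  rcases Nat.eq_zero_or_pos e with he0 | hepos
  · refine le_max_of_le_right ?_
    rw [he0, Nat.sub_zero] at hGh
    have : Nonempty (Fin n) := ⟨⟨0, by omega⟩⟩
    have hM := (hermitianMax_isGreatest q d U).2 ⟨G, hGh, hG0, rfl⟩
    rw [he0, zero_mul, zero_add, hZ', card_affine_inter q U hGh hd, hKw, ← hw] at hmain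
    rw [← hw]
    refine Nat.le_of_mul_le_mul_left (c := w) ?_ (by omega)
    have := Nat.mul_le_mul_left (w * (w + 1)) hM
    nlinarith
  refine le_max_of_le_left ?_
  rcases hed.lt_or_eq with hlt | heq
  · have hZB : Z.card ≤ (d - e) * (q + 1) * (q ^ 2) ^ (n - 2) := by
      have := card_isotropic_zeros_le hq hU (by rw [hUr, hcard]) (by rw [hcard]; exact hn)
        hGh hG0 (by omega) (by omega)
      rwa [hcard, ← hZ'] at this
    rw [← hw] at hmain
    refine (le_of_fiber_bound hepos (by omega) hNle hZS hZB ?_ hmain).trans_eq ?_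
    · exact Nat.mul_pos (Nat.mul_pos (by omega) (by omega)) hX0
    · rw [show d - 1 = e - 1 + (d - e) by omega]
      ring
  -- Here `G` is a nonzero constant, so even the zero vector is not in `Z`.
  · have hZ0 : Z = ∅ := by
      rw [heq, Nat.sub_self] at hGh
      obtain ⟨c, hc⟩ : ∃ c, G = MvPolynomial.C c :=
        ⟨_, MvPolynomial.totalDegree_eq_zero_iff_eq_C.1 (Nat.le_zero.1 hGh.totalDegree_le)⟩
      refine Finset.filter_eq_empty_iff.2 fun x _ hx => hG0 ?_
      rw [hc, MvPolynomial.eval_C] at hx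
      rw [hc, hx, map_zero]
    rw [hZ0, Finset.card_empty, mul_zero, add_zero, Nat.sub_zero] at hmain
    rw [← heq, mul_assoc]
    exact le_of_fiber_bound_of_no_zeros hepos (by omega) hNle hmain

end Main
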